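/- \textbf{Definitions.} Let $\pi_1:\omega^2\to\omega$ be the first projection. An ultrafilter $\mathcal W$ on $\omega^2$ is a \emph{non-P-point in standard position} if $\pi_1$ is neither finite-to-one nor constant on any set in $\mathcal W$ (such a $\mathcal W$ is automatically nonprincipal and not a P-point). $\mathcal W$ has the \emph{three-functions property} if every function $f$ on $\omega^2$ is, when restricted to some set in $\mathcal W$, either one-to-one, or constant, or the composition of $\pi_1$ followed by a one-to-one function. Let $\mathfrak N$ be the standard model of full arithmetic, i.e., the structure with underlying set $\omega$ in the language that has symbols for all functions and all relations of arbitrary finite arity on $\omega$. For an ultrafilter $\mathcal U$ on a set $S$, let $\mathcal U\text{-prod}\,\mathfrak N$ be the ultrapower of $\mathfrak N$ by $\mathcal U$. A function $f:S\to R$ induces an elementary embedding $f_*: f(\mathcal U)\text{-prod}\,\mathfrak N\to\mathcal U\text{-prod}\,\mathfrak N$, $[g]\mapsto[g\circ f]$, where $f(\mathcal U)=\{A\subseteq R: f^{-1}(A)\in\mathcal U\}$. An elementary extension $\mathfrak B$ of $\mathfrak A$ is \emph{conservative} if, for every parametrically definable subset $X$ of $\mathfrak B$, the set $X\cap|\mathfrak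 A|$ is parametrically definable in $\mathfrak A$. The map $f$ is a \emph{conservative map} on $\mathcal U$ if $\mathcal U\text{-prod}\,\mathfrak N$ is a conservative extension of the image of $f_*$. An \emph{$n$-type} is a linear pre-order of the $2n$ formal symbols $x_1,\dots,x_n,y_1,\dots,y_n$ such that $y_1<\dots<y_n$, each $x_i$ strictly precedes $y_i$, and any two distinct symbols that are equivalent in the pre-order are both $x$'s. Let $T(n)$ be the number of $n$-types. An ultrafilter $\mathcal U$ on $S$ is \emph{$(n,t)$-weakly Ramsey} if, whenever the set $[S]^n$ of $n$-element subsets of $S$ is partitioned into finitely many pieces, there is $H\in\mathcal U$ such that $[H]^n$ meets at most $t$ of the pieces. \textbf{Theorem.} Let $\mathcal W$ be a non-P-point on $\omega^2$ in standard position. If $\mathcal W$ has the three-functions property and $\pi_1$ is a conservative map on $\mathcal W$, then $\mathcal W$ is $(n,T(n))$-weakly Ramsey for every $n\in\omega$. -/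

import Mathlib

open Filter
open scoped FirstOrder

namespace WeakRamsey

/-! ### Non-P-points in standard position -/

/-- The restriction of `f` to `A` is finite-to-one. -/
def FiniteToOneOn {S Y : Type} (f : S → Y) (A : Set S) : Prop :=
  ∀ y, {s ∈ A | f s = y}.Finite

/-- The restriction of `f` to `A` is constant. -/
def ConstantOn {S Y : Type} (f : S → Y) (A : Set S) : Prop :=
  ∃ y, ∀ s ∈ A, f s = y

/-- A P-point: a nonprincipal ultrafilter such that every function is finite-to-one or constant on
some set in the ultrafilter. -/
def IsPPoint {S : Type} (U : Ultrafilter S) : Prop :=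
  (U : Filter S) ≤ cofinite ∧
    ∀ f : S → ℕ, ∃ A ∈ U, FiniteToOneOn f A ∨ ConstantOn f A

/-- A non-P-point in standard position: an ultrafilter on `ω²` such that the first projection is
neither finite-to-one nor constant on any set in the ultrafilter. Such an ultrafilter is
automatically nonprincipal and not a P-point, see the two lemmas below. -/
def StandardPosition (W : Ultrafilter (ℕ × ℕ)) : Prop :=
  ∀ A ∈ W, ¬ FiniteToOneOn (Prod.fst : ℕ × ℕ → ℕ) A ∧
    ¬ ConstantOn (Prod.fst : ℕ × ℕ → ℕ) A

theorem StandardPosition.le_cofinite {W : Ultrafilter (ℕ × ℕ)} (hW : StandardPosition W) :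
    (W : Filter (ℕ × ℕ)) ≤ cofinite := by
  intro A hA
  by_contra h
  have hc : Aᶜ ∈ W := Ultrafilter.compl_mem_iff_notMem.2 h
  exact (hW _ hc).1 fun y => (mem_cofinite.1 hA).subset fun s hs => hs.1

theorem StandardPosition.not_isPPoint {W : Ultrafilter (ℕ × ℕ)} (hW : StandardPosition W) :
    ¬ IsPPoint W := by
  rintro ⟨-, h⟩
  obtain ⟨A, hA, h1 | h2⟩ := h Prod.fst
  · exact (hW A hA).1 h1
  · exact (hW A hA).2 h2

/-! ### The three-functions property -/

/-- Every function on `ω²` is, on some set in `W`, one-to-one, or constant, or `π₁` followed by a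
one-to-one function. As `ω²` is countable, it is enough to consider functions with values
in `ω`. -/
def ThreeFunctions (W : Ultrafilter (ℕ × ℕ)) : Prop :=
  ∀ f : ℕ × ℕ → ℕ, ∃ A ∈ W,
    Set.InjOn f A ∨ ConstantOn f A ∨
      ∃ g : ℕ → ℕ, Set.InjOn g (Prod.fst '' A) ∧ ∀ p ∈ A, f p = g p.1

/-! ### Conservative extensions and conservative maps -/

/-- `e` exhibits `B` as a conservative extension of (the image of) `A`: the trace on `A` of any
parametrically definable subset of `B` is parametrically definable in `A`. -/
def IsConservative {L : FirstOrder.Language.{0, 0}} {A B : Type} [L.Structure A] [L.Structure B]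
    (e : A ↪ₑ[L] B) : Prop :=
  ∀ X : Set B, (Set.univ : Set B).Definable₁ L X →
    (Set.univ : Set A).Definable₁ L (e ⁻¹' X)

/-- The language of full arithmetic: it has symbols for all functions and all relations of
arbitrary finite arity on the natural numbers. -/
def fullArith : FirstOrder.Language.{0, 0} where
  Functions n := (Fin n → ℕ) → ℕ
  Relations n := (Fin n → ℕ) → Prop

/-- The standard model of full arithmetic. -/
instance standardModel : fullArith.Structure ℕ where
  funMap f x := f x
  RelMap R x := R x

/-- The ultrapower of the standard model with respect to `U`. Its `fullArith`-structure is the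
ultraproduct structure of Mathlib. -/
abbrev Ultrapower {S : Type} (U : Ultrafilter S) : Type :=
  (U : Filter S).Product fun _ : S => ℕ

/-- The class `[g]` of a function in the ultrapower. -/
def Ultrapower.mk {S : Type} (U : Ultrafilter S) (g : S → ℕ) : Ultrapower U :=
  Quotient.mk'' g

/-- The elementary embedding `f_*` of the ultrapower by the image ultrafilter `f(U)` into
the ultrapower by `U`, sending `[g]` to `[g ∘ f]`. -/
def ultrapowerEmb {S R : Type} (U : Ultrafilter S) (f : S → R) :
    Ultrapower (U.map f) ↪ₑ[fullArith] Ultrapower U where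
  toFun := Quotient.map' (fun g : R → ℕ => g ∘ f) fun _ _ h => h
  map_formula' := by
    intro n φ x
    obtain ⟨y, rfl⟩ : ∃ y : Fin n → R → ℕ, x = fun i => Ultrapower.mk (U.map f) (y i) :=
      ⟨fun i => (x i).out, funext fun i => (Quotient.out_eq (x i)).symm⟩
    exact (FirstOrder.Language.Ultraproduct.realize_formula_cast (u := U) (M := fun _ => ℕ) φ
      (fun i => y i ∘ f)).trans
      (FirstOrder.Language.Ultraproduct.realize_formula_cast (u := U.map f) (M := fun _ => ℕ) φ y).symm

theorem ultrapowerEmb_mk {S R : Type} (U : Ultrafilter S) (f : S → R) (g : R → ℕ) :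
    ultrapowerEmb U f (Ultrapower.mk (U.map f) g) = Ultrapower.mk U (g ∘ f) := rfl

/-- `f` is a conservative map on `U`: the ultrapower by `U` is a conservative extension of the
image under `f_*` of the ultrapower by `f(U)`. -/
def IsConservativeMap {S R : Type} (f : S → R) (U : Ultrafilter S) : Prop :=
  IsConservative (ultrapowerEmb U f)

/-! ### Types and weak Ramsey properties -/

/-- An `n`-type: a linear pre-order `le` of the `2n` formal symbols `x_i` (`Sum.inl i`) and
`y_i` (`Sum.inr i`) such that the `y_i` are strictly increasing, each `x_i` precedes `y_i`, and any
two distinct equivalent symbols are both `x`'s. -/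
structure IsNType {n : ℕ} (le : Fin n ⊕ Fin n → Fin n ⊕ Fin n → Prop) : Prop where
  refl : ∀ s, le s s
  trans : ∀ s t u, le s t → le t u → le s u
  total : ∀ s t, le s t ∨ le t s
  y_lt_y : ∀ i j, i < j → le (.inr i) (.inr j) ∧ ¬ le (.inr j) (.inr i)
  x_lt_y : ∀ i, le (.inl i) (.inr i) ∧ ¬ le (.inr i) (.inl i)
  equiv : ∀ s t, s ≠ t → le s t → le t s → s.isLeft ∧ t.isLeft

/-- `T n` is the (finite) number of `n`-types. -/
noncomputable def T (n : ℕ) : ℕ :=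
  Set.ncard {le : Fin n ⊕ Fin n → Fin n ⊕ Fin n → Prop | IsNType le}

/-- `U` is `(n, t)`-weakly Ramsey: whenever the set of `n`-element subsets of `S` is partitioned
into finitely many pieces (the fibres of a colouring `c`), there is a set `H ∈ U` such that the
`n`-element subsets of `H` meet at most `t` of the pieces. -/
def IsWeaklyRamsey {S : Type} (n t : ℕ) (U : Ultrafilter S) : Prop :=
  ∀ (k : ℕ) (c : {s : Finset S // s.card = n} → Fin k), ∃ H ∈ U,
    (c '' {s | (s.1 : Set S) ⊆ H}).ncard ≤ t

end WeakRamsey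

/-!
Fix a pre-order of the symbols `x_i`, `y_i`. The tuples of pairs that induce it amount to increasing
tuples of numbers, each entry being either a first coordinate or the second coordinate that goes
with an earlier entry. It suffices that every property of tuples of pairs is decided, on some set
in `W`, for the tuples inducing a given pre-order
(`ThreeFunctions.exists_homogeneous_inducedOrder`): with finitely many
pre-orders and colours, a single set in `W` then serves for all of them, and on it a colour is
determined by the `n`-type of any tuple having it.

To decide a property, eliminate the variables of the increasing tuple, beginning with the largest
(`ThreeFunctions.exists_homogeneous`).

* If the last variable is a first coordinate, its elimination is passage to the limit along
  `π₁(W)` (`ThreeFunctions.exists_eliminate_fst`).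
* If it is the second coordinate over an earlier entry `x`, conservativity provides the limit:
  it says that the truth of `F (z, y)`, for `W`-most `(x, y)` and parameters `z` chosen as any
  function of `x`, is decided by `x` and `z` alone (`IsConservativeMap.exists_trace`,
  `ThreeFunctions.exists_eliminate_snd`).

In both cases the limit has to be correct for all parameters that occur below the last variable, not
only for those fixed in advance. The three-functions property is used for this twice. The
least code of a parameter for which the limit is wrong, as a function of the pair, is one-to-one
on a set in `W`, so wrong parameters are large compared to the variable
(`ThreeFunctions.exists_bound_snd`, `ThreeFunctions.exists_bound_fst`). And the coordinates of the
elements of a set in `W` can be made as sparse as desired (`ThreeFunctions.exists_lt_of_lt`),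
because `π₁(W)` is selective and, even after a finite-to-one map, differs from `π₂(W)`
(`ThreeFunctions.map_fst_ne_map_snd`). Sparseness excludes parameters that are large compared to the
variable and yet below it.
-/

namespace WeakRamsey

/-! ### Conservativity in terms of families of sets -/

/-- Conservativity makes the traces of internal sets internal: whether `[g ∘ π₁]` belongs to the
internal set `[R]` is decided by a family of sets that depends on the first coordinate only. -/
theorem IsConservativeMap.exists_trace {W : Ultrafilter (ℕ × ℕ)}
    (hcons : IsConservativeMap (Prod.fst : ℕ × ℕ → ℕ) W) (R : ℕ × ℕ → Set ℕ) :
    ∃ Q : ℕ → Set ℕ, ∀ g : ℕ → ℕ,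
      (∀ᶠ p in (W : Filter (ℕ × ℕ)), g p.1 ∈ R p) ↔
        ∀ᶠ p in (W : Filter (ℕ × ℕ)), g p.1 ∈ Q p.1 := by
  let S : fullArith.Relations 2 := fun x : Fin 2 → ℕ => x 1 ∈ R (Nat.unpair (x 0))
  let h : Ultrapower W := Ultrapower.mk W fun p => Nat.pair p.1 p.2
  let X : Set (Ultrapower W) := {b | FirstOrder.Language.Structure.RelMap S ![h, b]}
  have hX : (Set.univ : Set (Ultrapower W)).Definable₁ fullArith X := by
    refine Set.definable_iff_exists_formula_sum.2
      ⟨S.formula₂ (.var (.inl ⟨h, trivial⟩)) (.var (.inr 0)), ?_⟩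
    ext v
    simp only [Set.mem_ofPred_eq, FirstOrder.Language.Formula.realize_rel₂,
      FirstOrder.Language.Term.realize_var, Sum.elim_inl, Sum.elim_inr, X]
  have hmemX : ∀ g : ℕ × ℕ → ℕ, Ultrapower.mk W g ∈ X ↔
      ∀ᶠ p in (W : Filter (ℕ × ℕ)), g p ∈ R p := by
    intro g
    have := FirstOrder.Language.Ultraproduct.realize_formula_cast (u := W) (M := fun _ => ℕ)
      (S.formula₂ (.var (0 : Fin 2)) (.var 1)) ![fun p => Nat.pair p.1 p.2, g]
    simp only [FirstOrder.Language.Formula.realize_rel₂,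
      FirstOrder.Language.Term.realize_var] at this
    refine Iff.trans ?_ (this.trans ?_)
    · rfl
    · refine eventually_congr (Eventually.of_forall fun p => ?_)
      change g p ∈ R (Nat.unpair (Nat.pair p.1 p.2)) ↔ _
      rw [Nat.unpair_pair]
  obtain ⟨φ, hφ⟩ := Set.definable_iff_exists_formula_sum.1 (hcons X hX)
  -- Łoś's theorem turns the defining formula, whose parameters are represented by functions, into
  -- a family of sets of natural numbers.
  refine ⟨fun x => {m | φ.Realize
    (Sum.elim (fun a => (Quotient.out a.1 : ℕ → ℕ) x) fun _ : Fin 1 => m)}, fun g => ?_⟩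
  have h1 := Set.ext_iff.1 hφ fun _ => Ultrapower.mk (W.map Prod.fst) g
  have h2 := FirstOrder.Language.Ultraproduct.realize_formula_cast (u := W.map Prod.fst)
    (M := fun _ => ℕ) φ (Sum.elim (fun a => (Quotient.out a.1 : ℕ → ℕ)) fun _ : Fin 1 => g)
  have h3 := hmemX fun p => g p.1
  refine h3.symm.trans (h1.trans (Iff.trans ?_ (h2.trans ?_)))
  · refine iff_of_eq (congrArg φ.Realize (funext fun i => ?_))
    rcases i with a | i
    · exact (Quotient.out_eq a.1).symm
    · rfl
  · change (∀ᶠ x in map Prod.fst (W : Filter (ℕ × ℕ)), _) ↔ _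
    rw [eventually_map]
    refine eventually_congr (Eventually.of_forall fun p => ?_)
    refine iff_of_eq (congrArg φ.Realize (funext fun i => ?_))
    rcases i with a | i <;> rfl

/-! ### Functions on the ultrafilter -/

theorem StandardPosition.not_injOn_fst {W : Ultrafilter (ℕ × ℕ)} (hW : StandardPosition W)
    {A : Set (ℕ × ℕ)} (hA : A ∈ W) : ¬ Set.InjOn Prod.fst A := fun h =>
  (hW A hA).1 fun _ => Set.Subsingleton.finite fun _ hs _ ht =>
    h hs.1 ht.1 (hs.2.trans ht.2.symm)

theorem StandardPosition.eventually_fst_notMem {W : Ultrafilter (ℕ × ℕ)} (hW : StandardPosition W)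
    {F : Set ℕ} (hF : F.Finite) : ∀ᶠ p in (W : Filter (ℕ × ℕ)), p.1 ∉ F := by
  rw [Ultrafilter.eventually_not]
  intro h
  have h' : ∀ᶠ p in (W : Filter (ℕ × ℕ)), ∃ x ∈ F, p.1 = x :=
    h.mono fun p hp => ⟨p.1, hp, rfl⟩
  obtain ⟨x, -, hx⟩ := (Ultrafilter.eventually_exists_mem_iff hF).1 h'
  exact (hW _ hx).2 ⟨x, fun _ h => h⟩

theorem ThreeFunctions.injOn_or_fst {W : Ultrafilter (ℕ × ℕ)} (h3 : ThreeFunctions W)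
    (f : ℕ × ℕ → ℕ) : ∃ A ∈ W, Set.InjOn f A ∨ ∃ g : ℕ → ℕ, ∀ p ∈ A, f p = g p.1 := by
  obtain ⟨A, hA, h | ⟨y, h⟩ | ⟨g, -, h⟩⟩ := h3 f
  · exact ⟨A, hA, .inl h⟩
  · exact ⟨A, hA, .inr ⟨fun _ => y, h⟩⟩
  · exact ⟨A, hA, .inr ⟨g, h⟩⟩

/-- The image of the ultrafilter under the first projection is selective. -/
theorem ThreeFunctions.injOn_image_fst_or {W : Ultrafilter (ℕ × ℕ)} (h3 : ThreeFunctions W)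
    (hW : StandardPosition W) (f : ℕ → ℕ) :
    ∃ A ∈ W, Set.InjOn f (Prod.fst '' A) ∨ ∃ c, ∀ p ∈ A, f p.1 = c := by
  obtain ⟨A, hA, h | h | ⟨g, hg, h⟩⟩ := h3 fun p => f p.1
  · exact (hW.not_injOn_fst hA fun p hp q hq hpq => h hp hq (congrArg f hpq)).elim
  · exact ⟨A, hA, .inr h⟩
  · refine ⟨A, hA, .inl ?_⟩
    rintro _ ⟨p, hp, rfl⟩ _ ⟨q, hq, rfl⟩ hpq
    exact hg ⟨p, hp, rfl⟩ ⟨q, hq, rfl⟩ ((h p hp).symm.trans (hpq.trans (h q hq)))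

theorem ThreeFunctions.injOn_image_fst {W : Ultrafilter (ℕ × ℕ)} (h3 : ThreeFunctions W)
    (hW : StandardPosition W) {e : ℕ → ℕ} (he : ∀ c, (e ⁻¹' {c}).Finite) :
    ∃ A ∈ W, Set.InjOn e (Prod.fst '' A) := by
  obtain ⟨A, hA, h | ⟨c, h⟩⟩ := h3.injOn_image_fst_or hW e
  · exact ⟨A, hA, h⟩
  · obtain ⟨p, hp, hpA⟩ := ((hW.eventually_fst_notMem (he c)).and hA).exists
    exact (hp (h p hpA)).elim

theorem ThreeFunctions.injOn_snd {W : Ultrafilter (ℕ × ℕ)} (h3 : ThreeFunctions W)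
    (hW : StandardPosition W) {e : ℕ → ℕ} (he : ∀ c, (e ⁻¹' {c}).Finite) :
    ∃ A ∈ W, Set.InjOn (fun p : ℕ × ℕ => e p.2) A := by
  obtain ⟨A, hA, h | ⟨g, h⟩⟩ := h3.injOn_or_fst fun p => e p.2
  · exact ⟨A, hA, h⟩
  · refine ((hW A hA).1 fun x => ((he (g x)).image fun y => (x, y)).subset ?_).elim
    rintro ⟨_, y⟩ ⟨hp, rfl⟩
    exact ⟨y, h _ hp, rfl⟩

/-- For finite-to-one `e`, the ultrafilters `e(π₁(W))` and `e(π₂(W))` are distinct: they are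
isomorphic to `π₁(W)` and `W`, and the former is selective while the latter is not. -/
theorem ThreeFunctions.map_fst_ne_map_snd {W : Ultrafilter (ℕ × ℕ)} (h3 : ThreeFunctions W)
    (hW : StandardPosition W) {e : ℕ → ℕ} (he : ∀ c, (e ⁻¹' {c}).Finite) :
    W.map (fun p => e p.1) ≠ W.map fun p => e p.2 := by
  intro heq
  have hmem : ∀ T : Set ℕ, (∀ᶠ p in (W : Filter (ℕ × ℕ)), e p.1 ∈ T) →
      ∀ᶠ p in (W : Filter (ℕ × ℕ)), e p.2 ∈ T := fun T hT => by
    have : T ∈ W.map fun p => e p.1 := hT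
    rw [heq] at this
    exact this
  obtain ⟨A, hA, hinj⟩ := h3.injOn_snd hW he
  -- `k` recovers the first coordinate from `e` of the second one.
  let k : ℕ → ℕ := fun m => (Function.invFunOn (fun p : ℕ × ℕ => e p.2) A m).1
  have hk : ∀ p ∈ A, k (e p.2) = p.1 := fun p hp => congrArg Prod.fst (hinj.leftInvOn_invFunOn hp)
  obtain ⟨B, hB, h | ⟨c, h⟩⟩ := h3.injOn_image_fst_or hW fun x => k (e x)
  · have h1 := hmem (e '' (Prod.fst '' B)) (mem_of_superset hB fun p hp => ⟨_, ⟨p, hp, rfl⟩, rfl⟩)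
    refine hW.not_injOn_fst (inter_mem h1 hA) ?_
    rintro p ⟨⟨x, hx, hxp⟩, hp⟩ q ⟨⟨y, hy, hyq⟩, hq⟩ hpq
    have hxy : x = y := h hx hy (by simp only [hxp, hyq, hk p hp, hk q hq, hpq])
    exact hinj hp hq (by simp only [← hxp, ← hyq, hxy])
  · have h1 := hmem {m | k m = c} (mem_of_superset hB h)
    exact (hW _ (inter_mem h1 hA)).2 ⟨c, fun p hp => (hk p hp.2).symm.trans hp.1⟩

theorem ThreeFunctions.exists_separated {W : Ultrafilter (ℕ × ℕ)} (h3 : ThreeFunctions W)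
    (hW : StandardPosition W) {e : ℕ → ℕ} (he : ∀ c, (e ⁻¹' {c}).Finite) :
    ∃ A ∈ W, Set.InjOn e (Prod.fst '' A) ∧ Set.InjOn (fun p : ℕ × ℕ => e p.2) A ∧
      ∀ p ∈ A, ∀ q ∈ A, e p.1 ≠ e q.2 := by
  obtain ⟨A, hA, h1⟩ := h3.injOn_image_fst hW he
  obtain ⟨B, hB, h2⟩ := h3.injOn_snd hW he
  obtain ⟨T, hT1, hT2⟩ : ∃ T, T ∈ W.map (fun p => e p.1) ∧ T ∉ W.map fun p => e p.2 := by
    by_contra! h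
    exact h3.map_fst_ne_map_snd hW he (Ultrafilter.eq_of_le fun T hT => by
      by_contra hT'
      exact Ultrafilter.compl_mem_iff_notMem.1 (h _ (Ultrafilter.compl_mem_iff_notMem.2 hT')) hT)
  refine ⟨(A ∩ B) ∩ {p | e p.1 ∈ T ∧ e p.2 ∉ T},
    inter_mem (inter_mem hA hB) (inter_mem hT1 (Ultrafilter.compl_mem_iff_notMem.2 hT2)),
    h1.mono (Set.image_mono fun p hp => hp.1.1), h2.mono fun p hp => hp.1.2, ?_⟩
  exact fun p hp q hq hpq => hq.2.2 (hpq ▸ hp.2.1)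

/-! ### Sparse sets of coordinates -/

/-- The set of all coordinates of elements of `A`. -/
def coords (A : Set (ℕ × ℕ)) : Set ℕ := Prod.fst '' A ∪ Prod.snd '' A

theorem coords_mono {A B : Set (ℕ × ℕ)} (h : A ⊆ B) : coords A ⊆ coords B :=
  Set.union_subset_union (Set.image_mono h) (Set.image_mono h)

theorem ThreeFunctions.injOn_coords {W : Ultrafilter (ℕ × ℕ)} (h3 : ThreeFunctions W)
    (hW : StandardPosition W) {e : ℕ → ℕ} (he : ∀ c, (e ⁻¹' {c}).Finite) :
    ∃ A ∈ W, Set.InjOn e (coords A) := by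
  obtain ⟨A, hA, h1, h2, h12⟩ := h3.exists_separated hW he
  refine ⟨A, hA, ?_⟩
  rintro _ (hp | ⟨p, hp, rfl⟩) _ (hq | ⟨q, hq, rfl⟩) hpq
  · exact h1 hp hq hpq
  · obtain ⟨p, hp, rfl⟩ := hp
    exact (h12 p hp q hq hpq).elim
  · obtain ⟨q, hq, rfl⟩ := hq
    exact (h12 q hq p hp hpq.symm).elim
  · exact congrArg Prod.snd (h2 hp hq hpq)

/-- The natural numbers can be cut into successive finite intervals, `e m` being the index of the
interval of `m`, so that `φ` moves no number beyond the next interval. -/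
theorem exists_interval_index (φ : ℕ → ℕ) :
    ∃ e : ℕ → ℕ, Monotone e ∧ (∀ c, (e ⁻¹' {c}).Finite) ∧ ∀ a b, b ≤ φ a → e b ≤ e a + 1 := by
  let ψ : ℕ → ℕ := fun m => m + 1 + ∑ j ∈ Finset.range (m + 1), φ j
  have hψ : Monotone ψ := fun a b hab => by
    have := Finset.sum_le_sum_of_subset (f := φ) (Finset.range_mono (Nat.succ_le_succ hab))
    simp only [ψ]
    exact add_le_add (by omega) this
  have hφψ : ∀ a, φ a ≤ ψ a := fun a =>
    (Finset.single_le_sum (fun _ _ => Nat.zero_le _) (Finset.self_mem_range_succ a)).trans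
      (Nat.le_add_left _ _)
  have hk : ∀ k, k ≤ ψ^[k] 0 := fun k => by
    induction k with
    | zero => exact Nat.zero_le _
    | succ k ih =>
      rw [Function.iterate_succ_apply']
      exact (Nat.succ_le_succ ih).trans (Nat.le_add_right _ _)
  have hex : ∀ m, ∃ k, m ≤ ψ^[k] 0 := fun m => ⟨m, hk m⟩
  refine ⟨fun m => Nat.find (hex m), fun a b hab => ?_, fun c => ?_, fun a b hab => ?_⟩
  · exact Nat.find_min' _ (hab.trans (Nat.find_spec (hex b)))
  · refine (Set.finite_Iic (ψ^[c] 0)).subset ?_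
    rintro m rfl
    exact Nat.find_spec (hex m)
  · refine Nat.find_min' _ ?_
    rw [Function.iterate_succ_apply']
    exact (hab.trans (hφψ a)).trans (hψ (Nat.find_spec (hex a)))

theorem ThreeFunctions.exists_lt_of_lt {W : Ultrafilter (ℕ × ℕ)} (h3 : ThreeFunctions W)
    (hW : StandardPosition W) (φ : ℕ → ℕ) :
    ∃ A ∈ W, ∀ a ∈ coords A, ∀ b ∈ coords A, a < b → φ a < b := by
  obtain ⟨e, hmono, hfin, he⟩ := exists_interval_index φ
  have hfin' : ∀ c, {m | e m ≤ c}.Finite := fun c => by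
    refine ((Set.finite_Iic c).biUnion fun i _ => hfin i).subset fun m hm => ?_
    exact Set.mem_biUnion (show e m ∈ Set.Iic c from hm) rfl
  -- Pairing off the intervals in both ways excludes coordinates in adjacent intervals.
  obtain ⟨A, hA, h1⟩ := h3.injOn_coords hW (e := fun m => e m / 2) fun c =>
    (hfin' (2 * c + 1)).subset fun m (hm : e m / 2 = c) => by
      simp only [Set.mem_ofPred_eq]; omega
  obtain ⟨B, hB, h2⟩ := h3.injOn_coords hW (e := fun m => (e m + 1) / 2) fun c =>
    (hfin' (2 * c + 1)).subset fun m (hm : (e m + 1) / 2 = c) => by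
      simp only [Set.mem_ofPred_eq]; omega
  refine ⟨A ∩ B, inter_mem hA hB, fun a ha b hb hab => ?_⟩
  by_contra! hle
  have hab1 := hmono hab.le
  have hab2 := he a b hle
  have ha1 := coords_mono Set.inter_subset_left ha
  have hb1 := coords_mono Set.inter_subset_left hb
  have ha2 := coords_mono Set.inter_subset_right ha
  have hb2 := coords_mono Set.inter_subset_right hb
  have h : e a / 2 = e b / 2 ∨ (e a + 1) / 2 = (e b + 1) / 2 := by omega
  exact hab.ne (h.elim (fun h => h1 ha1 hb1 h) fun h => h2 ha2 hb2 h)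

theorem ThreeFunctions.eventually_lt_snd {W : Ultrafilter (ℕ × ℕ)} (h3 : ThreeFunctions W)
    (hW : StandardPosition W) (m : ℕ) : ∀ᶠ p in (W : Filter (ℕ × ℕ)), m < p.2 := by
  obtain ⟨A, hA, h⟩ := h3.injOn_snd hW (e := id) fun c => Set.finite_singleton c
  by_contra hm
  rw [← Ultrafilter.eventually_not] at hm
  have hfin : (A ∩ {p | ¬ m < p.2}).Finite :=
    Set.Finite.of_finite_image ((Set.finite_Iic m).subset (by
      rintro _ ⟨p, hp, rfl⟩
      exact not_lt.1 hp.2)) (h.mono Set.inter_subset_left)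
  exact (hW _ (inter_mem hA hm)).1 fun y => hfin.subset fun s hs => hs.1

theorem StandardPosition.eventually_fst_lt_snd {W : Ultrafilter (ℕ × ℕ)}
    (hW : StandardPosition W) : ∀ᶠ p in (W : Filter (ℕ × ℕ)), p.1 < p.2 := by
  by_contra h
  rw [← Ultrafilter.eventually_not] at h
  refine (hW _ h).1 fun x => ((Set.finite_Iic x).image fun y => (x, y)).subset ?_
  rintro ⟨_, y⟩ ⟨hp, rfl⟩
  exact ⟨y, not_lt.1 hp, rfl⟩

/-- Sparseness relative to a function of tuples: `Φ` takes only finitely many values at the tuples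
with entries up to a given bound. -/
theorem ThreeFunctions.exists_sparse {W : Ultrafilter (ℕ × ℕ)} (h3 : ThreeFunctions W)
    (hW : StandardPosition W) {N : ℕ} (Φ : (Fin N → ℕ) → ℕ) :
    ∃ A ∈ W, ∀ b ∈ coords A, ∀ z : Fin N → ℕ, (∀ j, z j ∈ coords A ∧ z j < b) → Φ z < b := by
  have hfin : ∀ m : ℕ, ∃ s : ℕ, ∀ z : Fin N → ℕ, (∀ j, z j ≤ m) → Φ z ≤ s := fun m => by
    obtain ⟨s, hs⟩ := ((Set.finite_Iic fun _ : Fin N => m).image Φ).bddAbove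
    exact ⟨s, fun z hz => hs ⟨z, hz, rfl⟩⟩
  choose φ hφ using hfin
  obtain ⟨A, hA, h⟩ := h3.exists_lt_of_lt hW φ
  have hB : {p : ℕ × ℕ | p.1 ∉ Set.Iic (φ 0) ∧ φ 0 < p.2} ∈ W :=
    inter_mem (hW.eventually_fst_notMem (Set.finite_Iic (φ 0))) (h3.eventually_lt_snd hW (φ 0))
  refine ⟨A ∩ _, inter_mem hA hB, fun b hb z hz => ?_⟩
  have hb' := coords_mono Set.inter_subset_left hb
  rcases Nat.eq_zero_or_pos N with rfl | hN
  · refine (hφ 0 z fun j => j.elim0).trans_lt ?_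
    rcases hb with ⟨p, hp, rfl⟩ | ⟨p, hp, rfl⟩
    · exact not_le.1 hp.2.1
    · exact hp.2.2
  · have : Nonempty (Fin N) := ⟨⟨0, hN⟩⟩
    obtain ⟨i, hi⟩ := Finite.exists_max z
    exact (hφ (z i) z hi).trans_lt
      (h _ (coords_mono Set.inter_subset_left (hz i).1) b hb' (hz i).2)

/-! ### Bounding the exceptions -/

/-- If no `g ∘ π₁` selects an element of `D`, then each number belongs to `D p` only for `p` with
bounded second coordinate. Indeed, the least element of `D p` is not a function of the first
coordinate, so it is one-to-one by the three-functions property. -/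
theorem ThreeFunctions.exists_bound_snd {W : Ultrafilter (ℕ × ℕ)} (h3 : ThreeFunctions W)
    (D : ℕ × ℕ → Set ℕ)
    (hD : ∀ g : ℕ → ℕ, ¬ ∀ᶠ p in (W : Filter (ℕ × ℕ)), g p.1 ∈ D p) :
    ∃ Φ : ℕ → ℕ, ∀ᶠ p in (W : Filter (ℕ × ℕ)), ∀ z ∈ D p, p.2 ≤ Φ z := by
  obtain ⟨A, hA, h | ⟨g, h⟩⟩ := h3.injOn_or_fst fun p => sInf (D p)
  · have hfin : ∀ z, ∃ m, ∀ p ∈ A, sInf (D p) ≤ z → p.2 ≤ m := fun z => by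
      have hf : (A ∩ {p | sInf (D p) ≤ z}).Finite :=
        Set.Finite.of_finite_image ((Set.finite_Iic z).subset (by
          rintro _ ⟨p, hp, rfl⟩
          exact hp.2)) (h.mono Set.inter_subset_left)
      obtain ⟨m, hm⟩ := (hf.image Prod.snd).bddAbove
      exact ⟨m, fun p hp hz => hm ⟨p, ⟨hp, hz⟩, rfl⟩⟩
    choose Φ hΦ using hfin
    exact ⟨Φ, mem_of_superset hA fun p hp z hz => hΦ z p hp (Nat.sInf_le hz)⟩
  · by_cases hne : ∀ᶠ p in (W : Filter (ℕ × ℕ)), (D p).Nonempty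
    · refine (hD g ?_).elim
      filter_upwards [hne, hA] with p hp hpA
      exact h p hpA ▸ Nat.sInf_mem hp
    · refine ⟨fun _ => 0, ?_⟩
      filter_upwards [Ultrafilter.eventually_not.2 hne] with p hp z hz
      exact (hp ⟨z, hz⟩).elim

theorem ThreeFunctions.exists_bound_fst {W : Ultrafilter (ℕ × ℕ)} (h3 : ThreeFunctions W)
    (hW : StandardPosition W) (D : ℕ → Set ℕ)
    (hD : ∀ z : ℕ, ¬ ∀ᶠ p in (W : Filter (ℕ × ℕ)), z ∈ D p.1) :
    ∃ Φ : ℕ → ℕ, ∀ᶠ p in (W : Filter (ℕ × ℕ)), ∀ z ∈ D p.1, p.1 ≤ Φ z := by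
  obtain ⟨A, hA, h | ⟨c, h⟩⟩ := h3.injOn_image_fst_or hW fun x => sInf (D x)
  · have hfin : ∀ z, ∃ m, ∀ x ∈ Prod.fst '' A, sInf (D x) ≤ z → x ≤ m := fun z => by
      have hf : (Prod.fst '' A ∩ {x | sInf (D x) ≤ z}).Finite :=
        Set.Finite.of_finite_image ((Set.finite_Iic z).subset (by
          rintro _ ⟨p, hp, rfl⟩
          exact hp.2)) (h.mono Set.inter_subset_left)
      obtain ⟨m, hm⟩ := hf.bddAbove
      exact ⟨m, fun p hp hz => hm ⟨hp, hz⟩⟩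
    choose Φ hΦ using hfin
    exact ⟨Φ, mem_of_superset hA fun p hp z hz => hΦ z p.1 ⟨p, hp, rfl⟩ (Nat.sInf_le hz)⟩
  · by_cases hne : ∀ᶠ p in (W : Filter (ℕ × ℕ)), (D p.1).Nonempty
    · refine (hD c ?_).elim
      filter_upwards [hne, hA] with p hp hpA
      exact h p hpA ▸ Nat.sInf_mem hp
    · refine ⟨fun _ => 0, ?_⟩
      filter_upwards [Ultrafilter.eventually_not.2 hne] with p hp z hz
      exact (hp ⟨z, hz⟩).elim

/-! ### Homogeneous sets for tuples of a fixed shape -/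

/-- The first `N` terms of `a` are coordinates of elements of `A`, arranged as the shape `σ`
prescribes: `σ j = none` means that `a j` is a first coordinate, and `σ j = some i` means that
`a j` is the second coordinate of an element with first coordinate `a i`. -/
def Fits (σ : ℕ → Option ℕ) (A : Set (ℕ × ℕ)) (N : ℕ) (a : ℕ → ℕ) : Prop :=
  ∀ j < N, (σ j = none → a j ∈ Prod.fst '' A) ∧ ∀ i, σ j = some i → (a i, a j) ∈ A

theorem Fits.mono {σ : ℕ → Option ℕ} {A B : Set (ℕ × ℕ)} {M N : ℕ} {a : ℕ → ℕ}
    (h : Fits σ A N a) (hAB : A ⊆ B) (hMN : M ≤ N) : Fits σ B M a := fun j hj =>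
  ⟨fun hσ => Set.image_mono hAB ((h j (hj.trans_le hMN)).1 hσ),
    fun i hi => hAB ((h j (hj.trans_le hMN)).2 i hi)⟩

theorem Fits.mem_coords {σ : ℕ → Option ℕ} {A : Set (ℕ × ℕ)} {N : ℕ} {a : ℕ → ℕ}
    (h : Fits σ A N a) {j : ℕ} (hj : j < N) : a j ∈ coords A := by
  rcases hσ : σ j with _ | i
  · exact .inl ((h j hj).1 hσ)
  · exact .inr ⟨_, (h j hj).2 i hσ, rfl⟩

/-- Elimination of a last variable that is a second coordinate: on a set in `W`, the truth value
of `F (z, p.2)` depends only on `z`, provided that `p.1` is the `i`-th entry of `z` and the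
other entries of `z` are coordinates below `p.2`. -/
theorem ThreeFunctions.exists_eliminate_snd {W : Ultrafilter (ℕ × ℕ)} (h3 : ThreeFunctions W)
    (hW : StandardPosition W) (hcons : IsConservativeMap (Prod.fst : ℕ × ℕ → ℕ) W) {N : ℕ}
    (F : (Fin N → ℕ) → ℕ → Prop) (i : Fin N) :
    ∃ G : (Fin N → ℕ) → Prop, ∃ A ∈ W, ∀ p ∈ A, ∀ z : Fin N → ℕ, z i = p.1 →
      (∀ j, z j ∈ coords A ∧ z j < p.2) → (F z p.2 ↔ G z) := by
  obtain ⟨Q, hQ⟩ := hcons.exists_trace fun p => {m | ∃ z, Encodable.encode z = m ∧ F z p.2}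
  -- `D p` consists of the codes of those `z` for which the definition of the trace fails at `p`.
  obtain ⟨Φ, hΦ⟩ := h3.exists_bound_snd
    (fun p => {m | ∃ z : Fin N → ℕ, Encodable.encode z = m ∧ z i = p.1 ∧
      ¬ (F z p.2 ↔ m ∈ Q p.1)}) fun g hg => by
    have hR : ∀ᶠ p in (W : Filter (ℕ × ℕ)),
        ¬ ((∃ z, Encodable.encode z = g p.1 ∧ F z p.2) ↔ g p.1 ∈ Q p.1) := by
      filter_upwards [hg]
      rintro p ⟨z, hz, -, h⟩ h'
      refine h (h'.symm.trans ⟨?_, fun hF => ⟨z, hz, hF⟩⟩).symm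
      rintro ⟨z', hz', hF⟩
      exact Encodable.encode_injective (hz'.trans hz.symm) ▸ hF
    have hQg := hQ g
    by_cases h : ∀ᶠ p in (W : Filter (ℕ × ℕ)), g p.1 ∈ Q p.1
    · obtain ⟨p, h1, h2, h4⟩ := (hR.and (h.and (hQg.2 h))).exists
      exact h1 ⟨fun _ => h2, fun _ => h4⟩
    · obtain ⟨p, h1, h2, h4⟩ := (hR.and ((Ultrafilter.eventually_not.2 h).and
        (Ultrafilter.eventually_not.2 (mt hQg.1 h)))).exists
      exact h1 ⟨fun h => (h4 h).elim, fun h => (h2 h).elim⟩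
  obtain ⟨B, hB, hs⟩ := h3.exists_sparse hW fun z : Fin N → ℕ => Φ (Encodable.encode z)
  refine ⟨fun z => Encodable.encode z ∈ Q (z i), B ∩ _, inter_mem hB hΦ, fun p hp z hz hlt => ?_⟩
  by_contra hF
  have h1 := hp.2 (Encodable.encode z) ⟨z, rfl, hz, hz ▸ hF⟩
  have h2 := hs p.2 (.inr ⟨p, hp.1, rfl⟩) z fun j =>
    ⟨coords_mono Set.inter_subset_left (hlt j).1, (hlt j).2⟩
  exact h1.not_gt h2

/-- Elimination of a last variable that is a first coordinate. -/
theorem ThreeFunctions.exists_eliminate_fst {W : Ultrafilter (ℕ × ℕ)} (h3 : ThreeFunctions W)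
    (hW : StandardPosition W) {N : ℕ} (F : (Fin N → ℕ) → ℕ → Prop) :
    ∃ G : (Fin N → ℕ) → Prop, ∃ A ∈ W, ∀ p ∈ A, ∀ z : Fin N → ℕ,
      (∀ j, z j ∈ coords A ∧ z j < p.1) → (F z p.1 ↔ G z) := by
  let G : (Fin N → ℕ) → Prop := fun z => ∀ᶠ p in (W : Filter (ℕ × ℕ)), F z p.1
  obtain ⟨Φ, hΦ⟩ := h3.exists_bound_fst hW
    (fun x => {m | ∃ z : Fin N → ℕ, Encodable.encode z = m ∧ ¬ (F z x ↔ G z)}) fun m hm => by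
    obtain ⟨p, z, rfl, -⟩ := hm.exists
    have hm' : ∀ᶠ p in (W : Filter (ℕ × ℕ)), ¬ (F z p.1 ↔ G z) := by
      filter_upwards [hm]
      rintro p ⟨z', hz', h⟩
      exact Encodable.encode_injective hz' ▸ h
    by_cases h : G z
    · obtain ⟨p, h1, h2⟩ := (hm'.and h).exists
      exact h1 ⟨fun _ => h, fun _ => h2⟩
    · obtain ⟨p, h1, h2⟩ := (hm'.and (Ultrafilter.eventually_not.2 h)).exists
      exact h1 ⟨fun h' => (h2 h').elim, fun h' => (h h').elim⟩
  obtain ⟨B, hB, hs⟩ := h3.exists_sparse hW fun z : Fin N → ℕ => Φ (Encodable.encode z)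
  refine ⟨G, B ∩ _, inter_mem hB hΦ, fun p hp z hlt => ?_⟩
  by_contra hF
  have h1 := hp.2 (Encodable.encode z) ⟨z, rfl, hF⟩
  have h2 := hs p.1 (.inl ⟨p, hp.1, rfl⟩) z fun j =>
    ⟨coords_mono Set.inter_subset_left (hlt j).1, (hlt j).2⟩
  exact h1.not_gt h2

/-- Every property of tuples is decided, for the increasing tuples of a given shape with entries
from a suitable set in `W`. The variables are eliminated one after the other, beginning with
the largest. -/
theorem ThreeFunctions.exists_homogeneous {W : Ultrafilter (ℕ × ℕ)} (h3 : ThreeFunctions W)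
    (hW : StandardPosition W) (hcons : IsConservativeMap (Prod.fst : ℕ × ℕ → ℕ) W)
    (σ : ℕ → Option ℕ) (hσ : ∀ j i, σ j = some i → i < j) (N : ℕ) (F : (Fin N → ℕ) → Prop) :
    ∃ c : Prop, ∃ A ∈ W, ∀ a : ℕ → ℕ, StrictMonoOn a (Set.Iio N) → Fits σ A N a →
      (F (fun i => a i) ↔ c) := by
  induction N with
  | zero => exact ⟨F Fin.elim0, Set.univ, univ_mem, fun a _ _ =>
      iff_of_eq (congrArg F (Subsingleton.elim _ _))⟩
  | succ N ih =>
    obtain ⟨G, B, hB, hG⟩ : ∃ G : (Fin N → ℕ) → Prop, ∃ B ∈ W, ∀ a : ℕ → ℕ,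
        StrictMonoOn a (Set.Iio (N + 1)) → Fits σ B (N + 1) a →
          (F (fun i => a i) ↔ G fun i => a i) := by
      have hsnoc : ∀ a : ℕ → ℕ, (fun i : Fin (N + 1) => a i) =
          Fin.snoc (α := fun _ => ℕ) (fun i : Fin N => a i) (a N) := fun a => by
        ext j
        cases j using Fin.lastCases <;> simp
      have hlt : ∀ (B : Set (ℕ × ℕ)) (a : ℕ → ℕ), StrictMonoOn a (Set.Iio (N + 1)) →
          Fits σ B (N + 1) a → ∀ j : Fin N, a j ∈ coords B ∧ a j < a N := fun B a ha hf j =>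
        ⟨hf.mem_coords (j.2.trans N.lt_succ_self),
          ha (j.2.trans N.lt_succ_self) N.lt_succ_self j.2⟩
      rcases hN : σ N with _ | i
      · obtain ⟨G, B, hB, h⟩ := h3.exists_eliminate_fst hW
          fun (z : Fin N → ℕ) y => F (Fin.snoc (α := fun _ => ℕ) z y)
        refine ⟨G, B, hB, fun a ha hf => ?_⟩
        obtain ⟨p, hp, hpa⟩ := (hf N N.lt_succ_self).1 hN
        rw [hsnoc, ← hpa]
        exact h p hp _ (hpa ▸ hlt B a ha hf)
      · obtain ⟨G, B, hB, h⟩ := h3.exists_eliminate_snd hW hcons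
          (fun (z : Fin N → ℕ) y => F (Fin.snoc (α := fun _ => ℕ) z y)) ⟨i, hσ N i hN⟩
        refine ⟨G, B, hB, fun a ha hf => ?_⟩
        rw [hsnoc]
        exact h (a i, a N) ((hf N N.lt_succ_self).2 i hN) _ rfl (hlt B a ha hf)
    obtain ⟨c, A, hA, h⟩ := ih G
    refine ⟨c, A ∩ B, inter_mem hA hB, fun a ha hf => ?_⟩
    exact (hG a ha (hf.mono Set.inter_subset_right le_rfl)).trans
      (h a (ha.mono (Set.Iio_subset_Iio N.le_succ))
        (hf.mono Set.inter_subset_left N.le_succ))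

/-! ### Types of tuples of pairs -/

/-- The value of the formal symbol `x_i` or `y_i` at a tuple of pairs. -/
def symbolValue {n : ℕ} (p : Fin n → ℕ × ℕ) : Fin n ⊕ Fin n → ℕ :=
  Sum.elim (fun i => (p i).1) fun i => (p i).2

/-- The pre-order of the formal symbols induced by their values at a tuple of pairs. -/
def inducedOrder {n : ℕ} (p : Fin n → ℕ × ℕ) (s t : Fin n ⊕ Fin n) : Prop :=
  symbolValue p s ≤ symbolValue p t

theorem exists_rank {α : Type*} [Fintype α] (v : α → ℕ) :
    ∃ (N : ℕ) (r : α → Fin N), Function.Surjective r ∧ ∀ s t, r s ≤ r t ↔ v s ≤ v t := by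
  classical
  let I := Finset.univ.image v
  have hI : ∀ s, v s ∈ I := fun s => Finset.mem_image_of_mem v (Finset.mem_univ s)
  let e := I.orderIsoOfFin rfl
  refine ⟨I.card, fun s => e.symm ⟨v s, hI s⟩, fun j => ?_, fun s t => ?_⟩
  · obtain ⟨s, -, hs⟩ := Finset.mem_image.1 (e j).2
    refine ⟨s, ?_⟩
    rw [e.symm_apply_eq]
    exact Subtype.ext hs
  · rw [e.symm.le_iff_le]
    rfl

/-- Tuples inducing a given order correspond to increasing tuples of a fixed shape. -/
theorem ThreeFunctions.exists_homogeneous_inducedOrder {W : Ultrafilter (ℕ × ℕ)}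
    (h3 : ThreeFunctions W) (hW : StandardPosition W)
    (hcons : IsConservativeMap (Prod.fst : ℕ × ℕ → ℕ) W) {n : ℕ}
    (le : Fin n ⊕ Fin n → Fin n ⊕ Fin n → Prop) (F : (Fin n → ℕ × ℕ) → Prop) :
    ∃ c : Prop, ∃ A ∈ W, ∀ p : Fin n → ℕ × ℕ, (∀ i, p i ∈ A) → inducedOrder p = le →
      (F p ↔ c) := by
  classical
  have hlt := hW.eventually_fst_lt_snd
  by_cases hne : ∃ q : Fin n → ℕ × ℕ, (∀ i, (q i).1 < (q i).2) ∧ inducedOrder q = le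
  swap
  · exact ⟨True, _, hlt, fun p hp hle => (hne ⟨p, hp, hle⟩).elim⟩
  obtain ⟨q, hq, rfl⟩ := hne
  obtain ⟨N, r, hr, hrq⟩ := exists_rank (symbolValue q)
  let σ : ℕ → Option ℕ := fun j =>
    if h : ∃ i, (r (.inr i) : ℕ) = j then some (r (.inl h.choose)) else none
  have hσ_some : ∀ j i, σ j = some i →
      ∃ k, (r (.inr k) : ℕ) = j ∧ (r (.inl k) : ℕ) = i := fun j i h => by
    by_cases hj : ∃ i, (r (.inr i) : ℕ) = j
    · simp only [σ, dif_pos hj, Option.some.injEq] at h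
      exact ⟨hj.choose, hj.choose_spec, h⟩
    · simp only [σ, dif_neg hj, reduceCtorEq] at h
  have hσ_none : ∀ j, σ j = none → ∀ k, (r (.inr k) : ℕ) ≠ j := fun j h k hk => by
    have hj : ∃ i, (r (.inr i) : ℕ) = j := ⟨k, hk⟩
    simp only [σ, dif_pos hj, reduceCtorEq] at h
  obtain ⟨c, A, hA, hc⟩ := h3.exists_homogeneous hW hcons σ (fun j i h => by
      obtain ⟨k, rfl, rfl⟩ := hσ_some j i h
      exact Fin.lt_def.1 (not_le.1 fun hle => (hq k).not_ge ((hrq _ _).1 hle))) N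
    fun z => F fun i => (z (r (.inl i)), z (r (.inr i)))
  refine ⟨c, A, hA, fun p hp hle => ?_⟩
  have hrp : ∀ s t, r s ≤ r t ↔ symbolValue p s ≤ symbolValue p t := fun s t =>
    (hrq s t).trans (iff_of_eq (congrFun (congrFun hle s) t).symm)
  -- The values of the symbols at `p`, listed in increasing order.
  let a : ℕ → ℕ := fun j =>
    if h : j < N then symbolValue p (Function.surjInv hr ⟨j, h⟩) else 0
  have har : ∀ s, a (r s) = symbolValue p s := fun s => by
    simp only [a, dif_pos (r s).2]
    have h := Function.surjInv_eq hr (r s)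
    exact le_antisymm ((hrp _ _).1 h.le) ((hrp _ _).1 h.ge)
  have ha : StrictMonoOn a (Set.Iio N) := fun i hi j hj hij => by
    obtain ⟨s, hs⟩ := hr ⟨i, hi⟩
    obtain ⟨t, ht⟩ := hr ⟨j, hj⟩
    have h1 := har s
    have h2 := har t
    have h4 := hrp t s
    rw [hs] at h1 h4
    rw [ht] at h2 h4
    rw [h1, h2, ← not_le, ← h4]
    exact not_le.2 hij
  have hfit : Fits σ A N a := fun j hj => by
    refine ⟨fun hn => ?_, fun i hi => ?_⟩
    · obtain ⟨s | s, hs⟩ := hr ⟨j, hj⟩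
      · have h := har (.inl s)
        rw [hs] at h
        exact ⟨p s, hp s, h.symm⟩
      · exact (hσ_none j hn s (congrArg Fin.val hs)).elim
    · obtain ⟨k, rfl, rfl⟩ := hσ_some j i hi
      rw [har, har]
      exact hp k
  have h := hc a ha hfit
  simp only [har] at h
  exact h

/-- On a suitable set in `W`, all tuples with increasing second coordinates induce an `n`-type. -/
theorem ThreeFunctions.exists_isNType {W : Ultrafilter (ℕ × ℕ)} (h3 : ThreeFunctions W)
    (hW : StandardPosition W) :
    ∃ A ∈ W, Set.InjOn Prod.snd A ∧ ∀ (n : ℕ) (p : Fin n → ℕ × ℕ), (∀ i, p i ∈ A) →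
      StrictMono (fun i => (p i).2) → IsNType (inducedOrder p) := by
  obtain ⟨A, hA, -, h2, h12⟩ := h3.exists_separated hW (e := id) fun c => Set.finite_singleton c
  refine ⟨A ∩ _, inter_mem hA hW.eventually_fst_lt_snd, h2.mono Set.inter_subset_left,
    fun n p hp hmono => ⟨fun s => le_rfl, fun s t u => le_trans, fun s t => le_total _ _,
      fun i j hij => ⟨(hmono hij).le, (hmono hij).not_ge⟩,
      fun i => ⟨(hp i).2.le, (hp i).2.not_ge⟩, ?_⟩⟩
  rintro (i | i) (j | j) hne h1 h4
  · exact ⟨rfl, rfl⟩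
  · exact (h12 _ (hp i).1 _ (hp j).1 (le_antisymm h1 h4)).elim
  · exact (h12 _ (hp j).1 _ (hp i).1 (le_antisymm h4 h1)).elim
  · exact (hne (congrArg _ (hmono.injective (le_antisymm h1 h4)))).elim

theorem exists_enumeration {n : ℕ} (s : Finset (ℕ × ℕ)) (hs : s.card = n)
    (hinj : Set.InjOn Prod.snd (s : Set (ℕ × ℕ))) :
    ∃ p : Fin n → ℕ × ℕ, Finset.univ.image p = s ∧ StrictMono fun i => (p i).2 := by
  have hcard : (s.image Prod.snd).card = n := (Finset.card_image_of_injOn hinj).trans hs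
  have hex : ∀ i, ∃ q ∈ s, q.2 = (s.image Prod.snd).orderEmbOfFin hcard i := fun i =>
    Finset.mem_image.1 (Finset.orderEmbOfFin_mem _ hcard i)
  choose p hp hp2 using hex
  have hmono : StrictMono fun i => (p i).2 := fun i j hij => by
    simp only [hp2]
    exact ((s.image Prod.snd).orderEmbOfFin hcard).strictMono hij
  refine ⟨p, Finset.eq_of_subset_of_card_le ?_ ?_, hmono⟩
  · exact Finset.image_subset_iff.2 fun i _ => hp i
  · have hpinj : Function.Injective p := fun i j h => hmono.injective (congrArg Prod.snd h)
    rw [Finset.card_image_of_injective _ hpinj, hs, Finset.card_univ, Fintype.card_fin]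

end WeakRamsey

theorem mainTheorem1 (W : Ultrafilter (ℕ × ℕ)) (hW : WeakRamsey.StandardPosition W)
    (h3 : WeakRamsey.ThreeFunctions W)
    (hcons : WeakRamsey.IsConservativeMap (Prod.fst : ℕ × ℕ → ℕ) W) (n : ℕ) :
    WeakRamsey.IsWeaklyRamsey n (WeakRamsey.T n) W := by
  intro k c
  obtain ⟨B, hB, hinj, htype⟩ := h3.exists_isNType hW
  have hhom := fun (le : Fin n ⊕ Fin n → Fin n ⊕ Fin n → Prop) (d : Fin k) =>
    h3.exists_homogeneous_inducedOrder hW hcons le fun p =>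
      ∃ h : (Finset.univ.image p).card = n, c ⟨Finset.univ.image p, h⟩ = d
  choose b A hA hb using hhom
  refine ⟨B ∩ ⋂ le, ⋂ d, A le d, inter_mem hB (iInter_mem.2 fun le => iInter_mem.2 (hA le)), ?_⟩
  set H := B ∩ ⋂ le, ⋂ d, A le d
  have hHA : ∀ le d, H ⊆ A le d := fun le d =>
    Set.inter_subset_right.trans ((Set.iInter_subset _ le).trans (Set.iInter_subset _ d))
  have hcol : ∀ d ∈ c '' {s | (s.1 : Set (ℕ × ℕ)) ⊆ H}, ∃ p : Fin n → ℕ × ℕ,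
      (∀ i, p i ∈ H) ∧ StrictMono (fun i => (p i).2) ∧
        ∃ h : (Finset.univ.image p).card = n, c ⟨Finset.univ.image p, h⟩ = d := by
    rintro _ ⟨⟨s, hs⟩, hsH, rfl⟩
    obtain ⟨p, rfl, hp⟩ := WeakRamsey.exists_enumeration s hs
      (hinj.mono (hsH.trans Set.inter_subset_left))
    exact ⟨p, fun i => hsH (Finset.mem_coe.2 (Finset.mem_image_of_mem p (Finset.mem_univ i))), hp,
      hs, rfl⟩
  choose! p hpH hpm hpc using hcol
  -- Each colour is sent to the type of a tuple of that colour; by homogeneity this is one-to-one.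
  refine Set.ncard_le_ncard_of_injOn (fun d => WeakRamsey.inducedOrder (p d)) (fun d hd =>
    htype n (p d) (fun i => (hpH d hd i).1) (hpm d hd)) (fun d hd d' hd' hdd' => ?_) (Set.toFinite _)
  have h1 := (hb _ d (p d) (fun i => hHA _ _ (hpH d hd i)) rfl).1 (hpc d hd)
  obtain ⟨h, hd'd⟩ := (hb _ d (p d') (fun i => hHA _ _ (hpH d' hd' i)) hdd'.symm).2 h1
  obtain ⟨h', hd'd'⟩ := hpc d' hd'
  exact hd'd.symm.trans hd'd'
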